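/- Let $p$ be a prime and let $G=\prod_{i=1}^{k}C_{p^{r_i}}$ be a finite non-cyclic abelian $p$-group, where $k\ge 2$, $r_1\ge r_2\ge\cdots\ge r_k$ and $C_{p^{r_i}}$ is cyclic of order $p^{r_i}$, and let $x_1$ be a generator of the factor $C_{p^{r_1}}$. A stem extension of $G$ is a short exact sequence $1\to N\xrightarrow{\iota}\hat G\xrightarrow{\pi} G\to 1$ with $\iota(N)\subseteq Z(\hat G)\cap \hat G'$; a Schur cover $\tilde G$ of $G$ is a stem extension of maximal order. The deep commuting graph $\Delta_D(G)$ is the simple graph with vertex set $G$ in which two distinct elements are adjacent if and only if their preimages in a Schur cover $\tilde G$ of $G$ commute. A vertex is dominant if it is adjacent to all other vertices. Then, whichever Schur cover of $G$ is used, the set of dominant vertices of $\Delta_D(G)$ is the cyclic subgroup $\langle x_1^{p^{r_2}}\rangle$. In particular, this set is $\{e\}$ if and only if $r_1=r_2$. -/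

import Mathlib

universe u v

namespace GroupExtension

/-- A stem extension `1 → N → E → G → 1`: the image of `N` lies in `Z(E) ∩ E'`.
In particular the extension is central. -/
def IsStem {G : Type u} {N E : Type v} [Group G] [Group N] [Group E]
    (S : GroupExtension N E G) : Prop :=
  S.inl.range ≤ Subgroup.center E ⊓ commutator E

/-- A Schur cover of `G`: a (finite) stem extension of `G` of maximal order among all stem
extensions of `G`. By `IsStem.finite` below, every stem extension of a finite group is finite, so
`Nat.card` is the genuine order. -/
structure IsSchurCover {G : Type u} {N E : Type v} [Group G] [Group N] [Group E]
    (S : GroupExtension N E G) : Prop where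
  isStem : S.IsStem
  finite : Finite E
  card_le : ∀ (N' E' : Type v) [Group N'] [Group E'] (S' : GroupExtension N' E' G),
    S'.IsStem → Nat.card E' ≤ Nat.card E

/-- The deep commuting graph of `G`, formed with the extension `S` (a Schur cover of `G`): the
vertices are the elements of `G`, and two distinct elements are adjacent if their preimages
in `E` commute. For a central extension it does not matter which preimages are taken. -/
def deepCommutingGraph {G : Type u} {N E : Type v} [Group G] [Group N] [Group E]
    (S : GroupExtension N E G) : SimpleGraph G where
  Adj g h := g ≠ h ∧ ∀ a b : E, S.rightHom a = g → S.rightHom b = h → Commute a b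
  symm := ⟨fun _ _ H => ⟨H.1.symm, fun a b ha hb => (H.2 b a hb ha).symm⟩⟩
  loopless := ⟨fun _ H => H.1 rfl⟩

section Existence

open scoped commutatorElement

variable {G : Type u} {N E : Type v} [Group G] [Group N] [Group E]

theorem IsStem.commutatorSet_subset {S : GroupExtension N E G} (hS : S.IsStem) :
    commutatorSet E ⊆ Set.range (fun q : G × G =>
      ⁅Function.surjInv S.rightHom_surjective q.1, Function.surjInv S.rightHom_surjective q.2⁆) := by
  rintro _ ⟨a, b, rfl⟩
  refine ⟨(S.rightHom a, S.rightHom b), ?_⟩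
  have key : ∀ c : E, ∃ z ∈ Subgroup.center E,
      c = z * Function.surjInv S.rightHom_surjective (S.rightHom c) := by
    intro c
    refine ⟨c * (Function.surjInv S.rightHom_surjective (S.rightHom c))⁻¹, ?_, by simp⟩
    refine (hS ?_).1
    rw [S.range_inl_eq_ker_rightHom, MonoidHom.mem_ker, map_mul, map_inv,
      Function.surjInv_eq S.rightHom_surjective, mul_inv_cancel]
  obtain ⟨z, hz, ha⟩ := key a
  obtain ⟨w, hw, hb⟩ := key b
  dsimp only
  generalize Function.surjInv S.rightHom_surjective (S.rightHom a) = a' at ha ⊢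
  generalize Function.surjInv S.rightHom_surjective (S.rightHom b) = b' at hb ⊢
  subst ha hb
  rw [Subgroup.mem_center_iff] at hz hw
  have hwi : ∀ g, g * w⁻¹ = w⁻¹ * g := fun g =>
    ((show Commute g w from hw g).inv_right : Commute g w⁻¹)
  rw [commutatorElement_def, commutatorElement_def, mul_inv_rev, mul_inv_rev]
  calc a' * b' * a'⁻¹ * b'⁻¹
      = z * (a' * b' * a'⁻¹ * b'⁻¹) * z⁻¹ := by rw [← hz]; group
    _ = z * a' * b' * a'⁻¹ * (b'⁻¹ * z⁻¹) := by group
    _ = z * a' * b' * a'⁻¹ * (z⁻¹ * b'⁻¹) := by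
        rw [show b'⁻¹ * z⁻¹ = z⁻¹ * b'⁻¹ from
          ((show Commute b'⁻¹ z from hz _).inv_right : Commute b'⁻¹ z⁻¹)]
    _ = w * (z * a' * b' * (a'⁻¹ * z⁻¹) * b'⁻¹) * w⁻¹ := by rw [← hw]; group
    _ = (w * (z * a')) * b' * (a'⁻¹ * z⁻¹) * (b'⁻¹ * w⁻¹) := by group
    _ = z * a' * (w * b') * (a'⁻¹ * z⁻¹) * (b'⁻¹ * w⁻¹) := by rw [← hw]; group

variable [Finite G]

/-- The order of a stem extension of a finite group is bounded in terms of the group. -/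
theorem IsStem.finite_and_card_le {S : GroupExtension N E G} (hS : S.IsStem) :
    Finite E ∧ Nat.card E ≤ (∑ i ∈ Finset.range (Nat.card (G × G) + 1),
      Subgroup.cardCommutatorBound i) * Nat.card G := by
  have hfin : Finite (commutatorSet E) := (Set.finite_range _).subset hS.commutatorSet_subset
  have hle : Nat.card (commutatorSet E) ≤ Nat.card (G × G) :=
    (Nat.card_mono (Set.finite_range _) hS.commutatorSet_subset).trans
      (Finite.card_range_le _)
  have hker : S.rightHom.ker ≤ commutator E := by
    rw [← S.range_inl_eq_ker_rightHom]
    exact hS.trans inf_le_right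
  have hkfin : Finite S.rightHom.ker := Finite.of_injective _ (Subgroup.inclusion_injective hker)
  have hcard : Nat.card E = Nat.card S.rightHom.ker * Nat.card G := by
    rw [← S.rightHom.ker.card_mul_index, Subgroup.index_ker,
      MonoidHom.range_eq_top.2 S.rightHom_surjective, Subgroup.card_top]
  refine ⟨(Nat.card_pos_iff.1 (hcard ▸ Nat.mul_pos Nat.card_pos Nat.card_pos)).2, ?_⟩
  rw [hcard]
  refine Nat.mul_le_mul_right _ ?_
  calc Nat.card S.rightHom.ker ≤ Nat.card (commutator E) :=
        Nat.card_le_card_of_injective _ (Subgroup.inclusion_injective hker)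
    _ ≤ Subgroup.cardCommutatorBound (Nat.card (commutatorSet E)) :=
        Subgroup.card_commutator_le_of_finite_commutatorSet E
    _ ≤ _ := Finset.single_le_sum (f := Subgroup.cardCommutatorBound) (fun _ _ => Nat.zero_le _)
        (Finset.mem_range.2 (Nat.lt_succ_of_le hle))

theorem IsStem.finite {S : GroupExtension N E G} (hS : S.IsStem) : Finite E :=
  hS.finite_and_card_le.1

end Existence

/-- Every finite group has a Schur cover. -/
theorem exists_isSchurCover (G : Type u) [Group G] [Finite G] :
    ∃ (N E : Type v) (_ : Group N) (_ : Group E) (S : GroupExtension N E G),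
      S.IsSchurCover := by
  let P : Set ℕ := {m | ∃ (N E : Type v) (_ : Group N) (_ : Group E) (S : GroupExtension N E G),
    S.IsStem ∧ Nat.card E = m}
  have hne : P.Nonempty := by
    let S : GroupExtension PUnit.{v + 1} (Shrink.{v} G) G :=
      { inl := 1
        rightHom := (Shrink.mulEquiv.{v} (α := G)).toMonoidHom
        inl_injective := fun _ _ _ => rfl
        range_inl_eq_ker_rightHom := by
          rw [(MonoidHom.ker_eq_bot_iff _).2 (Shrink.mulEquiv.{v} (α := G)).injective]
          ext x
          simp
        rightHom_surjective := (Shrink.mulEquiv.{v} (α := G)).surjective }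
    refine ⟨_, PUnit.{v + 1}, Shrink.{v} G, inferInstance, inferInstance, S, ?_, rfl⟩
    rintro _ ⟨x, rfl⟩
    exact Subgroup.one_mem _
  have hbdd : BddAbove P := by
    refine ⟨(∑ i ∈ Finset.range (Nat.card (G × G) + 1),
      Subgroup.cardCommutatorBound i) * Nat.card G, ?_⟩
    rintro _ ⟨N, E, _, _, S, hS, rfl⟩
    exact hS.finite_and_card_le.2
  obtain ⟨N, E, _, _, S, hS, hm⟩ := Nat.sSup_mem hne hbdd
  refine ⟨N, E, _, _, S, hS, hS.finite, fun N' E' _ _ S' hS' => ?_⟩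
  rw [hm]
  exact le_csSup hbdd ⟨N', E', _, _, S', hS', rfl⟩

end GroupExtension

/-! In a stem extension of an abelian group, commutators of lifts define an alternating bilinear
pairing on `G` with central values (`IsStem.pairing`), and the dominant vertices form its radical
(`IsStem.mem_universalVerts_iff`). For generators `x i` of the cyclic factors, the value at a pair
`i < j` is killed by `p ^ r j`, so these values give a homomorphism from `PairwiseZMod p r` to the
centre, whose image contains the commutator subgroup and hence the kernel of the extension. An
explicit bilinear cocycle yields a stem extension with kernel of order exactly `|PairwiseZMod p r|`,
so a Schur cover has a kernel at least that large, and counting makes the homomorphism injective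
(`IsSchurCover.fromPairwiseZMod_injective`). Only this lower bound on the Schur multiplier is
needed.

The values at the pairs `i < j` are thus independent of exact orders `p ^ r j`. With indices
starting at 0, pairing an element of the radical with `x 0` kills every factor but the first, and
pairing with `x 1` makes the remaining exponent divisible by `p ^ r 1`. -/

/-- The central extension of `A` by `M` defined by a bilinear cocycle `f`: the set `A × M` with
multiplication `(a, m) * (b, n) = (a + b, m + n + f a b)`. -/
@[ext]
structure BilinearExtension {A : Type} {M : Type v} [AddCommGroup A] [AddCommGroup M]
    (f : A →+ A →+ M) where
  fst : A
  snd : M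

namespace BilinearExtension

variable {A : Type} {M : Type v} [AddCommGroup A] [AddCommGroup M] {f : A →+ A →+ M}

instance : Mul (BilinearExtension f) := ⟨fun x y => ⟨x.fst + y.fst, x.snd + y.snd + f x.fst y.fst⟩⟩

instance : One (BilinearExtension f) := ⟨⟨0, 0⟩⟩

-- The term `f x.fst x.fst` cancels the cocycle value `f (-x.fst) x.fst`.
instance : Inv (BilinearExtension f) := ⟨fun x => ⟨-x.fst, -x.snd + f x.fst x.fst⟩⟩

@[simp] theorem mul_fst (x y : BilinearExtension f) : (x * y).fst = x.fst + y.fst := rfl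

@[simp] theorem mul_snd (x y : BilinearExtension f) :
    (x * y).snd = x.snd + y.snd + f x.fst y.fst := rfl

@[simp] theorem one_fst : (1 : BilinearExtension f).fst = 0 := rfl

@[simp] theorem one_snd : (1 : BilinearExtension f).snd = 0 := rfl

@[simp] theorem inv_fst (x : BilinearExtension f) : x⁻¹.fst = -x.fst := rfl

@[simp] theorem inv_snd (x : BilinearExtension f) : x⁻¹.snd = -x.snd + f x.fst x.fst := rfl

instance : Group (BilinearExtension f) :=
  Group.ofLeftAxioms
    (fun x y z => by
      ext
      · simp [add_assoc]
      · simp only [mul_snd, mul_fst, map_add, AddMonoidHom.add_apply]; abel)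
    (fun x => by ext <;> simp)
    (fun x => by ext <;> simp)

theorem card_eq : Nat.card (BilinearExtension f) = Nat.card A * Nat.card M := by
  rw [← Nat.card_prod]
  exact Nat.card_congr ⟨fun x => (x.fst, x.snd), fun x => ⟨x.1, x.2⟩, fun _ => rfl, fun _ => rfl⟩

/-- The kernel inclusion of the extension defined by a bilinear cocycle. -/
def inl (f : A →+ A →+ M) : Multiplicative M →* BilinearExtension f where
  toFun m := ⟨0, m.toAdd⟩
  map_one' := rfl
  map_mul' x y := by ext <;> simp

/-- The projection of the extension defined by a bilinear cocycle. -/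
def proj (f : A →+ A →+ M) : BilinearExtension f →* Multiplicative A where
  toFun x := Multiplicative.ofAdd x.fst
  map_one' := rfl
  map_mul' _ _ := rfl

open scoped commutatorElement in
theorem commutator_mk (a b : A) (m n : M) :
    ⁅(⟨a, m⟩ : BilinearExtension f), (⟨b, n⟩ : BilinearExtension f)⁆ =
      ⟨0, f a b - f b a⟩ := by
  rw [commutatorElement_def, mul_inv_eq_iff_eq_mul, mul_inv_eq_iff_eq_mul]
  ext
  · simp [add_comm]
  · simp only [mul_snd, mul_fst, map_zero, AddMonoidHom.zero_apply, zero_add, add_zero]; abel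

/-- The group extension defined by a bilinear cocycle, with an identification of the quotient. -/
def groupExtension {G : Type*} [Group G] (f : A →+ A →+ M) (e : Multiplicative A ≃* G) :
    GroupExtension (Multiplicative M) (BilinearExtension f) G where
  inl := inl f
  rightHom := e.toMonoidHom.comp (proj f)
  inl_injective x y h := by
    exact congrArg BilinearExtension.snd h
  range_inl_eq_ker_rightHom := by
    ext x
    constructor
    · rintro ⟨m, rfl⟩
      simp [inl, proj, MonoidHom.mem_ker]
    · intro h
      have h' : x.fst = 0 := by simpa [proj, MonoidHom.mem_ker] using h
      exact ⟨Multiplicative.ofAdd x.snd, BilinearExtension.ext h'.symm rfl⟩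
  rightHom_surjective g := ⟨⟨(e.symm g).toAdd, 0⟩, by simp [proj]⟩

/-- The antisymmetrization of `f` gives the commutators, so `hf` puts the whole kernel in the
commutator subgroup. -/
theorem isStem_groupExtension {G : Type*} [Group G] (f : A →+ A →+ M) (e : Multiplicative A ≃* G)
    (hf : AddSubgroup.closure (Set.range fun q : A × A => f q.1 q.2 - f q.2 q.1) = ⊤) :
    (groupExtension f e).IsStem := by
  change (inl f).range ≤ _
  refine le_inf ?_ ?_
  · rintro _ ⟨m, rfl⟩
    rw [Subgroup.mem_center_iff]
    intro g
    ext <;> simp [inl, add_comm]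
  · rintro _ ⟨m, rfl⟩
    have hm : m.toAdd ∈ AddSubgroup.closure
        (Set.range fun q : A × A => f q.1 q.2 - f q.2 q.1) := hf ▸ AddSubgroup.mem_top _
    change inl f (Multiplicative.ofAdd m.toAdd) ∈ _
    generalize m.toAdd = m' at hm ⊢
    induction hm using AddSubgroup.closure_induction with
    | mem x hx =>
      obtain ⟨q, rfl⟩ := hx
      have := commutator_mk (f := f) q.1 q.2 0 0
      change (⟨0, f q.1 q.2 - f q.2 q.1⟩ : BilinearExtension f) ∈ _
      rw [← this]
      exact Subgroup.commutator_mem_commutator (Subgroup.mem_top _) (Subgroup.mem_top _)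
    | zero => exact one_mem _
    | add x y _ _ hx hy => rw [ofAdd_add, map_mul]; exact mul_mem hx hy
    | neg x _ hx => rw [ofAdd_neg, map_inv]; exact inv_mem hx

end BilinearExtension

/-! ### Bilinearity of commutators modulo centrality -/

section Commutator

open scoped commutatorElement

variable {E : Type v} [Group E]

theorem commutatorElement_mul_right_of_mem_center {a b c : E} (h : ⁅a, c⁆ ∈ Subgroup.center E) :
    ⁅a, b * c⁆ = ⁅a, b⁆ * ⁅a, c⁆ := by
  have h' : b * ⁅a, c⁆ = ⁅a, c⁆ * b := Subgroup.mem_center_iff.1 h b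
  calc ⁅a, b * c⁆ = ⁅a, b⁆ * (b * ⁅a, c⁆ * b⁻¹) := by
        simp only [commutatorElement_def]; group
    _ = ⁅a, b⁆ * ⁅a, c⁆ := by rw [h', mul_inv_cancel_right]

theorem commutatorElement_mul_left_of_mem_center {a b c : E} (h : ⁅b, c⁆ ∈ Subgroup.center E) :
    ⁅a * b, c⁆ = ⁅a, c⁆ * ⁅b, c⁆ := by
  rw [← commutatorElement_inv c b, inv_mem_iff] at h
  rw [← commutatorElement_inv, commutatorElement_mul_right_of_mem_center h, mul_inv_rev,
    commutatorElement_inv, commutatorElement_inv]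
  rw [← inv_mem_iff, commutatorElement_inv] at h
  exact (Subgroup.mem_center_iff.1 h _).symm

theorem commutatorElement_eq_one_of_mem_center_left {z : E} (hz : z ∈ Subgroup.center E) (a : E) :
    ⁅z, a⁆ = 1 :=
  commutatorElement_eq_one_iff_mul_comm.2 (Subgroup.mem_center_iff.1 hz a).symm

theorem commutatorElement_eq_one_of_mem_center_right {z : E} (hz : z ∈ Subgroup.center E) (a : E) :
    ⁅a, z⁆ = 1 :=
  commutatorElement_eq_one_iff_mul_comm.2 (Subgroup.mem_center_iff.1 hz a)

end Commutator

/-! ### The commutator pairing of a stem extension -/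

namespace GroupExtension

open scoped commutatorElement IsMulCommutative

variable {G : Type u} {N E : Type v} [CommGroup G] [Group N] [Group E] {S : GroupExtension N E G}

theorem IsStem.ker_le_center (hS : S.IsStem) : S.rightHom.ker ≤ Subgroup.center E := by
  rw [← S.range_inl_eq_ker_rightHom]
  exact hS.trans inf_le_left

theorem IsStem.ker_le_commutator (hS : S.IsStem) : S.rightHom.ker ≤ commutator E := by
  rw [← S.range_inl_eq_ker_rightHom]
  exact hS.trans inf_le_right

theorem IsStem.commutatorElement_mem_center (hS : S.IsStem) (a b : E) :
    ⁅a, b⁆ ∈ Subgroup.center E :=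
  hS.ker_le_center (by
    rw [MonoidHom.mem_ker, map_commutatorElement, commutatorElement_eq_one_iff_mul_comm, mul_comm])

/-- Two lifts of one element differ by a central factor, which drops out of commutators. -/
theorem IsStem.commutatorElement_congr (hS : S.IsStem) {a a' b b' : E}
    (ha : S.rightHom a = S.rightHom a') (hb : S.rightHom b = S.rightHom b') :
    ⁅a, b⁆ = ⁅a', b'⁆ := by
  have key : ∀ {c c' : E}, S.rightHom c = S.rightHom c' → ∃ z ∈ Subgroup.center E, c = c' * z :=
    fun {c c'} h => ⟨c'⁻¹ * c, hS.ker_le_center (by simp [MonoidHom.mem_ker, h]), by simp⟩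
  obtain ⟨z, hz, rfl⟩ := key ha
  obtain ⟨w, hw, rfl⟩ := key hb
  rw [commutatorElement_mul_left_of_mem_center (hS.commutatorElement_mem_center _ _),
    commutatorElement_eq_one_of_mem_center_left hz, mul_one,
    commutatorElement_mul_right_of_mem_center (hS.commutatorElement_mem_center _ _),
    commutatorElement_eq_one_of_mem_center_right hw, mul_one]

/-- The commutator pairing on an abelian group defined by a stem extension. -/
noncomputable def IsStem.pairing (hS : S.IsStem) : G →* G →* Subgroup.center E :=
  MonoidHom.mk' (fun g => MonoidHom.mk' (fun h =>
      ⟨⁅Function.surjInv S.rightHom_surjective g, Function.surjInv S.rightHom_surjective h⁆,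
        hS.commutatorElement_mem_center _ _⟩)
    (fun h h' => Subtype.ext <| by
      rw [Subgroup.coe_mul, ← commutatorElement_mul_right_of_mem_center
        (hS.commutatorElement_mem_center _ _)]
      -- The product of the chosen lifts is a lift of the product, though not necessarily the chosen
      -- one.
      exact hS.commutatorElement_congr rfl (by simp [Function.surjInv_eq])))
    (fun g g' => MonoidHom.ext fun h => Subtype.ext <| by
      change ⁅_, _⁆ = ⁅_, _⁆ * ⁅_, _⁆
      rw [← commutatorElement_mul_left_of_mem_center (hS.commutatorElement_mem_center _ _)]
      exact hS.commutatorElement_congr (by simp [Function.surjInv_eq]) rfl)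

theorem IsStem.coe_pairing (hS : S.IsStem) (a b : E) :
    (hS.pairing (S.rightHom a) (S.rightHom b) : E) = ⁅a, b⁆ :=
  hS.commutatorElement_congr (Function.surjInv_eq _ _) (Function.surjInv_eq _ _)

theorem IsStem.pairing_self (hS : S.IsStem) (g : G) : hS.pairing g g = 1 := by
  obtain ⟨a, rfl⟩ := S.rightHom_surjective g
  exact Subtype.ext (by rw [hS.coe_pairing, commutatorElement_self]; rfl)

theorem IsStem.pairing_swap (hS : S.IsStem) (g h : G) :
    hS.pairing h g = (hS.pairing g h)⁻¹ := by
  obtain ⟨a, rfl⟩ := S.rightHom_surjective g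
  obtain ⟨b, rfl⟩ := S.rightHom_surjective h
  exact Subtype.ext (by
    rw [hS.coe_pairing, Subgroup.coe_inv, hS.coe_pairing, commutatorElement_inv])

theorem IsStem.mem_universalVerts_iff (hS : S.IsStem) (g : G) :
    g ∈ S.deepCommutingGraph.universalVerts ↔ hS.pairing g = 1 := by
  constructor
  · intro hg
    ext1 h
    -- Dominance says nothing about `g` against itself; the pairing being alternating covers that
    -- case.
    rcases eq_or_ne g h with rfl | hne
    · exact hS.pairing_self g
    obtain ⟨a, rfl⟩ := S.rightHom_surjective g
    obtain ⟨b, rfl⟩ := S.rightHom_surjective h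
    refine Subtype.ext ?_
    rw [hS.coe_pairing]
    exact commutatorElement_eq_one_iff_commute.2 ((hg hne).2 a b rfl rfl)
  · intro hg h hne
    refine ⟨hne, ?_⟩
    rintro a b rfl rfl
    rw [← commutatorElement_eq_one_iff_commute, ← hS.coe_pairing, hg]
    rfl

theorem IsStem.commutator_le (hS : S.IsStem) {H : Subgroup (Subgroup.center E)}
    (hH : ∀ g h, hS.pairing g h ∈ H) : commutator E ≤ H.map (Subgroup.center E).subtype := by
  rw [commutator_def, Subgroup.commutator_le]
  intro a _ b _
  exact ⟨_, hH _ _, hS.coe_pairing a b⟩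

theorem card_eq_card_ker_mul (S : GroupExtension N E G) :
    Nat.card E = Nat.card S.rightHom.ker * Nat.card G := by
  rw [← S.rightHom.ker.card_mul_index, Subgroup.index_ker,
    MonoidHom.range_eq_top.2 S.rightHom_surjective, Subgroup.card_top]

end GroupExtension

/-! ### The explicit cocycle attaining the lower bound -/

/-- The product of the groups `ℤ / p ^ r j` over the pairs `i < j`. For antitone `r` this is the
Schur multiplier of the product of the cyclic groups of orders `p ^ r i`. -/
abbrev PairwiseZMod (p : ℕ) {k : ℕ} (r : Fin k → ℕ) : Type :=
  ∀ q : {q : Fin k × Fin k // q.1 < q.2}, ZMod (p ^ r q.1.2)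

namespace PairwiseZMod

variable {p k : ℕ} {r : Fin k → ℕ}

/-- The bilinear cocycle whose coordinate at a pair `i < j` is `(a, b) ↦ a i * b j`. -/
def cocycle (p : ℕ) (hr : Antitone r) :
    (∀ i, ZMod (p ^ r i)) →+ (∀ i, ZMod (p ^ r i)) →+ ULift.{v} (PairwiseZMod p r) :=
  AddMonoidHom.mk' (fun a => AddMonoidHom.mk' (fun b => ULift.up fun q =>
      ZMod.castHom (pow_dvd_pow p (hr q.2.le)) (ZMod (p ^ r q.1.2)) (a q.1.1) * b q.1.2)
    (fun b c => congrArg ULift.up (funext fun q => mul_add _ _ _)))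
    (fun a a' => AddMonoidHom.ext fun b => congrArg ULift.up (funext fun q => by
      rw [Pi.add_apply, map_add, add_mul]; rfl))

theorem cocycle_apply_down (hr : Antitone r) (a b : ∀ i, ZMod (p ^ r i))
    (q : {q : Fin k × Fin k // q.1 < q.2}) : (cocycle.{v} p hr a b).down q =
      ZMod.castHom (pow_dvd_pow p (hr q.2.le)) (ZMod (p ^ r q.1.2)) (a q.1.1) * b q.1.2 :=
  rfl

theorem cocycle_single_sub (hr : Antitone r) (q : {q : Fin k × Fin k // q.1 < q.2})
    (c : ZMod (p ^ r q.1.2)) :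
    cocycle.{v} p hr (Pi.single q.1.1 1) (Pi.single q.1.2 c) -
      cocycle.{v} p hr (Pi.single q.1.2 c) (Pi.single q.1.1 1) = ULift.up (Pi.single q c) := by
  refine ULift.down_injective (funext fun s => ?_)
  rw [ULift.sub_down, Pi.sub_apply, cocycle_apply_down, cocycle_apply_down]
  obtain ⟨⟨i, j⟩, hij⟩ := q
  obtain ⟨⟨i', j'⟩, hij'⟩ := s
  dsimp only at hij hij' c ⊢
  -- Both being nonzero would force `(i', j') = (j, i)`, against `i < j` and `i' < j'`.
  have h0 : (Pi.single j c : ∀ i, ZMod (p ^ r i)) i' = 0 ∨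
      (Pi.single i 1 : ∀ i, ZMod (p ^ r i)) j' = 0 := by
    by_contra! h
    have h1 : i' = j := by_contra fun hne => h.1 (Pi.single_eq_of_ne hne _)
    have h2 : j' = i := by_contra fun hne => h.2 (Pi.single_eq_of_ne hne _)
    exact absurd (h1 ▸ h2 ▸ hij') hij.asymm
  have h0' : ZMod.castHom (pow_dvd_pow p (hr hij'.le)) (ZMod (p ^ r j'))
      ((Pi.single j c : ∀ i, ZMod (p ^ r i)) i') * (Pi.single i 1 : ∀ i, ZMod (p ^ r i)) j' = 0 := by
    rcases h0 with h | h <;> rw [h] <;> simp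
  rw [h0', sub_zero]
  by_cases hi : i' = i
  · subst hi
    by_cases hj : j' = j
    · subst hj
      simp only [Pi.single_eq_same, map_one, one_mul]
    · rw [Pi.single_eq_of_ne hj, mul_zero, Pi.single_eq_of_ne]
      simp [hj]
  · rw [Pi.single_eq_of_ne hi, map_zero, zero_mul, Pi.single_eq_of_ne]
    simp [hi]

theorem closure_cocycle (hr : Antitone r) :
    AddSubgroup.closure (Set.range fun q : (∀ i, ZMod (p ^ r i)) × (∀ i, ZMod (p ^ r i)) =>
      cocycle.{v} p hr q.1 q.2 - cocycle.{v} p hr q.2 q.1) = ⊤ := by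
  refine (AddSubgroup.eq_top_iff' _).2 fun m => ?_
  refine AddSubgroup.pi_mem_of_single_mem (H := AddSubgroup.comap
    (AddEquiv.ulift.symm : PairwiseZMod p r ≃+ ULift.{v} (PairwiseZMod p r)).toAddMonoidHom
      (AddSubgroup.closure _)) m.down fun q => AddSubgroup.subset_closure ?_
  exact ⟨(Pi.single q.1.1 1, Pi.single q.1.2 (m.down q)), cocycle_single_sub hr q _⟩

end PairwiseZMod

/-! ### Independence of the commutators in a Schur cover -/

namespace GroupExtension

open scoped IsMulCommutative

section

variable {p k : ℕ} {r : Fin k → ℕ} {G : Type u} [CommGroup G]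

theorem exists_isStem_card_eq (hr : Antitone r)
    (e : Multiplicative (∀ i, ZMod (p ^ r i)) ≃* G) :
    ∃ (N E : Type v) (_ : Group N) (_ : Group E) (S : GroupExtension N E G),
      S.IsStem ∧ Nat.card E = Nat.card (PairwiseZMod p r) * Nat.card G := by
  refine ⟨_, _, _, _, BilinearExtension.groupExtension (PairwiseZMod.cocycle p hr) e,
    BilinearExtension.isStem_groupExtension _ e (PairwiseZMod.closure_cocycle hr), ?_⟩
  rw [BilinearExtension.card_eq, mul_comm, Nat.card_ulift, ← Nat.card_congr e.toEquiv]
  rfl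

variable {N E : Type v} [Group N] [Group E] {S : GroupExtension N E G}

/-- Maximality of the cover against the cocycle extension; the common factor `|G|` cancels. -/
theorem IsSchurCover.card_le_card_ker [Finite G] (hS : S.IsSchurCover) (hr : Antitone r)
    (e : Multiplicative (∀ i, ZMod (p ^ r i)) ≃* G) :
    Nat.card (PairwiseZMod p r) ≤ Nat.card S.rightHom.ker := by
  obtain ⟨N', E', _, _, S', hS', hcard⟩ := exists_isStem_card_eq.{u, v} hr e
  have h := hS.card_le N' E' S' hS'
  rw [hcard, S.card_eq_card_ker_mul] at h
  exact Nat.le_of_mul_le_mul_right h Nat.card_pos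

theorem IsStem.pairing_mem (hS : S.IsStem) {x : Fin k → G}
    (hgen : ∀ g, ∃ a : Fin k → ℤ, g = ∏ i, x i ^ a i) {H : Subgroup (Subgroup.center E)}
    (hH : ∀ i j, i < j → hS.pairing (x i) (x j) ∈ H) (g h : G) : hS.pairing g h ∈ H := by
  have hH' (i j) : hS.pairing (x i) (x j) ∈ H := by
    rcases lt_trichotomy i j with hij | rfl | hij
    · exact hH i j hij
    · rw [hS.pairing_self]; exact one_mem _
    · rw [hS.pairing_swap]; exact inv_mem (hH j i hij)
  obtain ⟨a, rfl⟩ := hgen g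
  obtain ⟨b, rfl⟩ := hgen h
  simp only [map_prod, MonoidHom.finsetProd_apply, map_zpow, MonoidHom.zpow_apply]
  exact prod_mem fun i _ => zpow_mem (prod_mem fun j _ => zpow_mem (hH' j i) _) _

/-- The homomorphism to the centre of a stem extension given by the commutators of lifts of
elements `x i` of order dividing `p ^ r i`. -/
noncomputable def IsStem.fromPairwiseZMod (hS : S.IsStem) (x : Fin k → G)
    (hx : ∀ i, x i ^ p ^ r i = 1) : PairwiseZMod p r →+ Additive (Subgroup.center E) :=
  ∑ q : {q : Fin k × Fin k // q.1 < q.2},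
    (ZMod.lift (p ^ r q.1.2)
      ⟨zmultiplesHom _ (Additive.ofMul (hS.pairing (x q.1.1) (x q.1.2))), by
        -- The power `p ^ r j` moves into the second argument of the pairing, where it kills `x j`.
        rw [zmultiplesHom_apply, natCast_zsmul, ← ofMul_pow, ← map_pow, hx, map_one, ofMul_one]⟩).comp
      (Pi.evalAddMonoidHom _ q)

theorem IsStem.fromPairwiseZMod_single (hS : S.IsStem) (x : Fin k → G)
    (hx : ∀ i, x i ^ p ^ r i = 1) (q : {q : Fin k × Fin k // q.1 < q.2}) (n : ℤ) :
    hS.fromPairwiseZMod x hx (Pi.single q (n : ZMod (p ^ r q.1.2))) =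
      Additive.ofMul (hS.pairing (x q.1.1) (x q.1.2) ^ n) := by
  rw [fromPairwiseZMod, AddMonoidHom.finsetSum_apply, Finset.sum_eq_single q]
  · simp only [AddMonoidHom.comp_apply, Pi.evalAddMonoidHom_apply, Pi.single_eq_same,
      ZMod.lift_coe, zmultiplesHom_apply, ofMul_zpow]
  · intro s _ hs
    simp only [AddMonoidHom.comp_apply, Pi.evalAddMonoidHom_apply, Pi.single_eq_of_ne hs, map_zero]
  · simp

/-- The kernel of the cover lies in the image of the map, so the finite source is no larger than the
image; a surjection onto a set at least as large is bijective. -/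
theorem IsSchurCover.fromPairwiseZMod_injective [Finite G] (hp : p ≠ 0) (hS : S.IsSchurCover)
    (hr : Antitone r) (e : Multiplicative (∀ i, ZMod (p ^ r i)) ≃* G) (x : Fin k → G)
    (hx : ∀ i, x i ^ p ^ r i = 1) (hgen : ∀ g, ∃ a : Fin k → ℤ, g = ∏ i, x i ^ a i) :
    Function.Injective (hS.isStem.fromPairwiseZMod x hx) := by
  have : Finite E := hS.finite
  have hne (i) : NeZero (p ^ r i) := ⟨pow_ne_zero _ hp⟩
  have : Finite (PairwiseZMod p r) := Pi.finite
  set φ := hS.isStem.fromPairwiseZMod x hx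
  let H : Subgroup (Subgroup.center E) := φ.range.toSubgroup'
  have hH : ∀ g h, hS.isStem.pairing g h ∈ H := by
    refine hS.isStem.pairing_mem hgen fun i j hij => ?_
    refine ⟨Pi.single ⟨(i, j), hij⟩ ((1 : ℤ) : ZMod (p ^ r j)), ?_⟩
    exact (hS.isStem.fromPairwiseZMod_single x hx ⟨(i, j), hij⟩ 1).trans
      (congrArg Additive.ofMul (zpow_one _))
  have hle : S.rightHom.ker ≤ H.map (Subgroup.center E).subtype :=
    hS.isStem.ker_le_commutator.trans (hS.isStem.commutator_le hH)
  have hcard : Nat.card (PairwiseZMod p r) ≤ Nat.card φ.range :=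
    calc _ ≤ Nat.card S.rightHom.ker := hS.card_le_card_ker hr e
      _ ≤ Nat.card (H.map (Subgroup.center E).subtype) :=
        Nat.card_le_card_of_injective _ (Subgroup.inclusion_injective hle)
      _ = Nat.card H := Subgroup.card_subtype _ _
      _ = Nat.card φ.range := rfl
  exact φ.rangeRestrict_injective_iff.1
    (φ.rangeRestrict_surjective.bijective_of_nat_card_le hcard).1

end

/-! ### The radical of the pairing -/

section

variable {p n : ℕ} {r : Fin (n + 2) → ℕ} {G : Type u} [CommGroup G] [Finite G]
  {N E : Type v} [Group N] [Group E] {S : GroupExtension N E G}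

theorem IsSchurCover.mem_universalVerts_iff (hp : p ≠ 0) (hS : S.IsSchurCover) (hr : Antitone r)
    (e : Multiplicative (∀ i, ZMod (p ^ r i)) ≃* G) (x : Fin (n + 2) → G)
    (hx : ∀ i, x i ^ p ^ r i = 1) (hgen : ∀ g, ∃ a : Fin (n + 2) → ℤ, g = ∏ i, x i ^ a i) (g : G) :
    g ∈ S.deepCommutingGraph.universalVerts ↔ g ∈ Subgroup.zpowers (x 0 ^ p ^ r 1) := by
  have hinj := hS.fromPairwiseZMod_injective hp hr e x hx hgen
  rw [hS.isStem.mem_universalVerts_iff]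
  constructor
  · intro hg
    obtain ⟨a, rfl⟩ := hgen g
    have h0 : ∀ j, 0 < j → ((a j : ℤ) : ZMod (p ^ r j)) = 0 := by
      -- `m` collects the exponents at the pairs `(0, i)`; its image is the pairing of `x 0` with
      -- the given element, which is trivial.
      let m : PairwiseZMod p r := ∑ i, if h : 0 < i then
        Pi.single ⟨(0, i), h⟩ ((a i : ℤ) : ZMod (p ^ r i)) else 0
      have hm : m = 0 := by
        apply hinj
        rw [map_zero, map_sum]
        have h1 : hS.isStem.pairing (x 0) (∏ i, x i ^ a i) = 1 := by
          rw [hS.isStem.pairing_swap, hg, MonoidHom.one_apply, inv_one]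
        refine Eq.trans ?_ (congrArg Additive.ofMul h1)
        rw [map_prod, ofMul_prod]
        refine Finset.sum_congr rfl fun i _ => ?_
        split_ifs with h
        · rw [hS.isStem.fromPairwiseZMod_single, map_zpow (hS.isStem.pairing (x 0))]
        · have : i = 0 := by simpa [Fin.pos_iff_ne_zero] using h
          rw [this, map_zpow (hS.isStem.pairing (x 0)), hS.isStem.pairing_self, one_zpow, map_zero, ofMul_one]
      intro j hj
      have h2 : m ⟨(0, j), hj⟩ = 0 := by rw [hm]; rfl
      rw [show m = ∑ i, _ from rfl, Finset.sum_apply, Finset.sum_eq_single j] at h2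
      · rwa [dif_pos hj, Pi.single_eq_same] at h2
      · intro i _ hij
        split_ifs with h
        · exact Pi.single_eq_of_ne (by simpa using hij.symm) _
        · rfl
      · simp
    have h1 : ∏ i, x i ^ a i = x 0 ^ a 0 := by
      refine Finset.prod_eq_single 0 (fun i _ hi => ?_) (by simp)
      obtain ⟨t, ht⟩ := (ZMod.intCast_zmod_eq_zero_iff_dvd _ _).1 (h0 i (Fin.pos_iff_ne_zero.2 hi))
      rw [ht, zpow_mul, zpow_natCast, hx, one_zpow]
    rw [h1] at hg ⊢
    -- Only a power of `x 0` is left; testing it against `x 1` bounds the exponent.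
    have h2 : (Pi.single ⟨(0, 1), by simp⟩ ((a 0 : ℤ) : ZMod (p ^ r 1)) : PairwiseZMod p r) = 0 := by
      apply hinj
      rw [hS.isStem.fromPairwiseZMod_single, map_zero]
      have h3 := DFunLike.congr_fun hg (x 1)
      rw [map_zpow, MonoidHom.zpow_apply, MonoidHom.one_apply] at h3
      exact congrArg Additive.ofMul h3
    rw [Pi.single_eq_zero_iff] at h2
    obtain ⟨t, ht⟩ := (ZMod.intCast_zmod_eq_zero_iff_dvd _ _).1 h2
    exact ⟨t, by rw [ht, zpow_mul, zpow_natCast]⟩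
  · rintro ⟨t, rfl⟩
    ext1 h
    obtain ⟨b, rfl⟩ := hgen h
    have key (i) : hS.isStem.pairing (x 0 ^ p ^ r 1) (x i) = 1 := by
      rcases eq_or_ne i 0 with rfl | hi
      · rw [map_pow, MonoidHom.pow_apply, hS.isStem.pairing_self, one_pow]
      -- For `i ≥ 1` the order of `x i` divides `p ^ r 1`, and the exponent moves to the second
      -- argument.
      · obtain ⟨s, hs⟩ := pow_dvd_pow p (hr (Fin.one_le_of_ne_zero hi))
        rw [map_pow, MonoidHom.pow_apply, ← map_pow, hs, pow_mul, hx, one_pow, map_one]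
    simp only [map_prod, map_zpow, MonoidHom.zpow_apply, key, one_zpow, Finset.prod_const_one,
      MonoidHom.one_apply]

end

end GroupExtension

theorem mainTheorem7 (p n : ℕ) (hp : p.Prime) (r : Fin (n + 2) → ℕ) (hr : Antitone r)
    (C : Fin (n + 2) → Type u) [∀ i, CommGroup (C i)] [∀ i, IsCyclic (C i)]
    (hC : ∀ i, Nat.card (C i) = p ^ r i)
    (G : Type u) [CommGroup G] (hG : ¬ IsCyclic G) (e : G ≃* ∀ i, C i)
    (x₁ : C 0) (hx₁ : ∀ y : C 0, y ∈ Subgroup.zpowers x₁)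
    (N E : Type v) [Group N] [Group E] (S : GroupExtension N E G) (hS : S.IsSchurCover) :
    S.deepCommutingGraph.universalVerts =
      (Subgroup.zpowers (e.symm (Pi.mulSingle 0 x₁) ^ p ^ r 1) : Set G) ∧
    (S.deepCommutingGraph.universalVerts = {1} ↔ r 0 = r 1) := by
  have hfin (i) : Finite (C i) :=
    Nat.finite_of_card_ne_zero (hC i ▸ pow_ne_zero _ hp.ne_zero)
  have : Finite G := Finite.of_equiv _ e.symm.toEquiv
  obtain ⟨y, hy0, hy⟩ : ∃ y : ∀ i, C i, y 0 = x₁ ∧ ∀ i z, z ∈ Subgroup.zpowers (y i) := by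
    choose y hy using fun i => IsCyclic.exists_generator (α := C i)
    refine ⟨Function.update y 0 x₁, Function.update_self .., fun i => ?_⟩
    rcases eq_or_ne i 0 with rfl | hi
    · rwa [Function.update_self]
    · rw [Function.update_of_ne hi]
      exact hy i
  let x : Fin (n + 2) → G := fun i => e.symm (Pi.mulSingle i (y i))
  have hx (i) : x i ^ p ^ r i = 1 := by
    rw [← map_pow, ← Pi.mulSingle_pow, ← hC, pow_card_eq_one', Pi.mulSingle_one, map_one]
  have hgen (g) : ∃ a : Fin (n + 2) → ℤ, g = ∏ i, x i ^ a i := by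
    choose a ha using fun i => Subgroup.mem_zpowers_iff.1 (hy i (e g i))
    refine ⟨a, e.injective ?_⟩
    rw [map_prod, ← Finset.univ_prod_mulSingle (e g)]
    refine Finset.prod_congr rfl fun i _ => ?_
    rw [map_zpow, MulEquiv.apply_symm_apply, ← Pi.mulSingle_zpow, ha]
  -- This isomorphism need not match the generators `x i`; it serves only to build the comparison
  -- extension of `G`.
  let e' : Multiplicative (∀ i, ZMod (p ^ r i)) ≃* G :=
    (MulEquiv.piMultiplicative fun i => ZMod (p ^ r i)).trans
      ((MulEquiv.piCongrRight fun i => mulEquivOfCyclicCardEq (by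
        rw [hC]; exact Nat.card_zmod _)).trans e.symm)
  have hx0 : e.symm (Pi.mulSingle 0 x₁) = x 0 := by rw [← hy0]
  have main : S.deepCommutingGraph.universalVerts =
      (Subgroup.zpowers (e.symm (Pi.mulSingle 0 x₁) ^ p ^ r 1) : Set G) :=
    Set.ext fun g => hx0 ▸ hS.mem_universalVerts_iff hp.ne_zero hr e' x hx hgen g
  refine ⟨main, ?_⟩
  -- The subgroup is trivial exactly when `p ^ r 0` divides `p ^ r 1`, that is `r 0 ≤ r 1`;
  -- antitonicity gives the other inequality.
  have horder : orderOf (e.symm (Pi.mulSingle 0 x₁)) = p ^ r 0 := by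
    rw [MulEquiv.orderOf_eq, orderOf_piMulSingle, orderOf_eq_card_of_forall_mem_zpowers hx₁, hC]
  rw [main, ← Subgroup.coe_bot, SetLike.coe_set_eq, Subgroup.zpowers_eq_bot,
    ← orderOf_dvd_iff_pow_eq_one, horder, Nat.pow_dvd_pow_iff_le_right hp.one_lt]
  exact ⟨fun h => h.antisymm (hr (Fin.zero_le 1)), fun h => h.le⟩
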